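/- Let $(\Omega,\Sigma,P)$ be a probability space and let $(\Sigma_n)$ be an increasing sequence of finite sub-$\sigma$-algebras of $\Sigma$, where $\Sigma_n$ is generated by a finite partition $\mathcal D_n$ of $\Omega$ into nonempty sets. Assume that $P(D)>0$ for all $n$ and all $D\in\mathcal D_n$, and that for each $n$ and each $D\in\mathcal D_n$ there is $m>n$ with $D\notin\mathcal D_m$. Let $$K=\Big\{(D_n)\in\prod_n\mathcal D_n : D_m\subset D_n \text{ for } m\ge n\Big\},$$ with the topology inherited from the product of the discrete spaces $\mathcal D_n$. For a martingale $f=(f_n)$ adapted to $(\Sigma_n)$ and $x=(D_n)\in K$, let $f_n(x)$ be the constant value of $f_n$ on $D_n$. For $1\le p<\infty$ let $M_p$ be the space of martingales $f=(f_n)$ adapted to $(\Sigma_n)$ with $\|f\|_p=\sup_n\|f_n\|_{L^p}<\infty$, equipped with this norm. Let $M_1^u\subset M_1$ be the subspace of uniformly integrable martingales and $M_1^s\subset M_1$ the subspace of martingales converging to $0$ almost surely, both with the norm of $M_1$. Let $Y$ be $M_1$, $M_1^u$, $M_1^s$, or $M_p$ for some $p\in(1,\infty)$. Then the set $$\{(f,x)\in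 Y\times K:\ \limsup_{n\to\infty} f_n(x)=+\infty\ \text{ and }\ \liminf_{n\to\infty} f_n(x)=-\infty\}$$ is a dense $G_\delta$ subset of $Y\times K$. In particular, there is a dense $G_\delta$ subset $A$ of $Y$ such that for every $f\in A$ there is a dense $G_\delta$ subset $B$ of $K$ with $$\limsup_{n\to\infty} f_n(x)=+\infty\quad\text{and}\quad\liminf_{n\to\infty} f_n(x)=-\infty\qquad\text{for all } x\in B.$$ -/

import Mathlib

open MeasureTheory Filter Topology
open scoped ENNReal

noncomputable section

namespace PartitionMartingale

universe u

variable {Ω : Type u}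

/-- The elements of the `n`-th partition, with the discrete topology. -/
def Cell (D : ℕ → Set (Set Ω)) (n : ℕ) : Type u := {d : Set Ω // d ∈ D n}

instance (D : ℕ → Set (Set Ω)) (n : ℕ) : TopologicalSpace (Cell D n) := ⊥

instance (D : ℕ → Set (Set Ω)) (n : ℕ) : DiscreteTopology (Cell D n) := ⟨rfl⟩

/-- The inverse limit `K` of the partitions `D n`: the sequences of cells `x n ∈ D n` with
`x m ⊆ x n` for `n ≤ m`. -/
def InverseLimit (D : ℕ → Set (Set Ω)) : Type u :=
  {x : (n : ℕ) → Cell D n // ∀ n m : ℕ, n ≤ m → (x m).1 ⊆ (x n).1}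

/-- `K` carries the subspace topology of the product of the discrete spaces `D n`. -/
instance (D : ℕ → Set (Set Ω)) : TopologicalSpace (InverseLimit D) :=
  inferInstanceAs (TopologicalSpace
    {x : (n : ℕ) → Cell D n // ∀ n m : ℕ, n ≤ m → (x m).1 ⊆ (x n).1})

/-- The `n`-th cell of a point of the inverse limit. -/
def InverseLimit.cell {D : ℕ → Set (Set Ω)} (x : InverseLimit D) (n : ℕ) : Set Ω := (x.1 n).1

open Classical in
/-- The value of a function on a set on which it is constant
(its value at a chosen point of the set; `0` for the empty set). -/
def cellValue (g : Ω → ℝ) (d : Set Ω) : ℝ :=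
  if h : d.Nonempty then g h.some else 0

/-- On a cell of a partition generating `m`, an `m`-measurable function is constant, and
`cellValue` is that constant. -/
theorem cellValue_eq {m : MeasurableSpace Ω} {C : Set (Set Ω)} (hC : Setoid.IsPartition C)
    (hm : m = MeasurableSpace.generateFrom C) {g : Ω → ℝ} (hg : Measurable[m] g)
    {d : Set Ω} (hd : d ∈ C) {ω : Ω} (hω : ω ∈ d) : cellValue g d = g ω := by
  have key : ∀ s : Set Ω, MeasurableSet[m] s → ∀ a ∈ d, ∀ b ∈ d, a ∈ s → b ∈ s := by
    intro s hs
    rw [hm] at hs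
    induction s, hs using MeasurableSpace.generateFrom_induction with
    | hC t ht _ =>
      intro a ha b hb hat
      have h : t = d := (hC.2 a).unique ⟨ht, hat⟩ ⟨hd, ha⟩
      rwa [h]
    | empty => intro a _ b _ h; exact h
    | compl t _ ih => intro a ha b hb hat hbt; exact hat (ih b hb a ha hbt)
    | iUnion t _ ih =>
      intro a ha b hb hat
      obtain ⟨i, hi⟩ := Set.mem_iUnion.1 hat
      exact Set.mem_iUnion.2 ⟨i, ih i a ha b hb hi⟩
  have hne : d.Nonempty := ⟨ω, hω⟩
  rw [cellValue, dif_pos hne]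
  exact key (g ⁻¹' {g ω}) (hg (measurableSet_singleton _)) ω hω _ hne.some_mem rfl

variable {mΩ : MeasurableSpace Ω}

/-- The vector space of martingales `f` adapted to `ℱ` with `sup_n ‖f_n‖_{L^p} < ∞`
(in particular `f_n ∈ L^p` for all `n`). -/
def boundedMartingales (P : Measure Ω) (ℱ : Filtration ℕ mΩ) (p : ℝ≥0∞) [Fact (1 ≤ p)] :
    Submodule ℝ (ℕ → Ω → ℝ) where
  carrier := {f | Martingale f ℱ P ∧ ⨆ n, eLpNorm (f n) p P < ∞}
  zero_mem' := ⟨martingale_zero ℝ ℱ P, by simp⟩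
  add_mem' := by
    rintro f g ⟨hf, hf'⟩ ⟨hg, hg'⟩
    refine ⟨hf.add hg, lt_of_le_of_lt (iSup_le fun n => ?_) (ENNReal.add_lt_top.2 ⟨hf', hg'⟩)⟩
    exact (eLpNorm_add_le (hf.integrable n).1 (hg.integrable n).1 Fact.out).trans
      (add_le_add (le_iSup (fun n => eLpNorm (f n) p P) n)
        (le_iSup (fun n => eLpNorm (g n) p P) n))
  smul_mem' := by
    rintro c f ⟨hf, hf'⟩
    refine ⟨hf.smul c, ?_⟩
    have hle : ∀ n, eLpNorm ((c • f) n) p P ≤ ‖c‖ₑ * ⨆ n, eLpNorm (f n) p P := by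
      intro n
      have h1 : eLpNorm (c • f n) p P ≤ ‖c‖ₑ * eLpNorm (f n) p P := eLpNorm_const_smul_le
      have h2 : eLpNorm (f n) p P ≤ ⨆ n, eLpNorm (f n) p P :=
        le_iSup (fun n => eLpNorm (f n) p P) n
      exact h1.trans (by gcongr)
    exact (iSup_le hle).trans_lt (ENNReal.mul_lt_top enorm_lt_top hf')

/-- The space `M_p`, as a type of its own: it carries the norm topology below, not the topology of
pointwise convergence of functions on `Ω`. -/
def Mp (P : Measure Ω) (ℱ : Filtration ℕ mΩ) (p : ℝ≥0∞) [Fact (1 ≤ p)] : Type u :=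
  ↥(boundedMartingales P ℱ p)

instance (P : Measure Ω) (ℱ : Filtration ℕ mΩ) (p : ℝ≥0∞) [Fact (1 ≤ p)] :
    AddCommGroup (Mp P ℱ p) := inferInstanceAs (AddCommGroup ↥(boundedMartingales P ℱ p))

instance (P : Measure Ω) (ℱ : Filtration ℕ mΩ) (p : ℝ≥0∞) [Fact (1 ≤ p)] :
    Module ℝ (Mp P ℱ p) := inferInstanceAs (Module ℝ ↥(boundedMartingales P ℱ p))

/-- The underlying sequence of functions of a martingale. -/
def Mp.seq {P : Measure Ω} {ℱ : Filtration ℕ mΩ} {p : ℝ≥0∞} [Fact (1 ≤ p)] (f : Mp P ℱ p) :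
    ℕ → Ω → ℝ := f.1

theorem Mp.martingale {P : Measure Ω} {ℱ : Filtration ℕ mΩ} {p : ℝ≥0∞} [Fact (1 ≤ p)]
    (f : Mp P ℱ p) : Martingale f.seq ℱ P := f.2.1

theorem Mp.iSup_lt_top {P : Measure Ω} {ℱ : Filtration ℕ mΩ} {p : ℝ≥0∞} [Fact (1 ≤ p)]
    (f : Mp P ℱ p) : ⨆ n, eLpNorm (f.seq n) p P < ∞ := f.2.2

theorem Mp.seq_zero {P : Measure Ω} {ℱ : Filtration ℕ mΩ} {p : ℝ≥0∞} [Fact (1 ≤ p)] (n : ℕ) :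
    (0 : Mp P ℱ p).seq n = 0 := rfl

theorem Mp.seq_add {P : Measure Ω} {ℱ : Filtration ℕ mΩ} {p : ℝ≥0∞} [Fact (1 ≤ p)]
    (f g : Mp P ℱ p) (n : ℕ) : (f + g).seq n = f.seq n + g.seq n := rfl

theorem Mp.seq_neg {P : Measure Ω} {ℱ : Filtration ℕ mΩ} {p : ℝ≥0∞} [Fact (1 ≤ p)]
    (f : Mp P ℱ p) (n : ℕ) : (-f).seq n = -f.seq n := rfl

/-- `‖f‖_p = sup_n ‖f_n‖_{L^p}`. -/
def Mp.seminorm (P : Measure Ω) (ℱ : Filtration ℕ mΩ) (p : ℝ≥0∞) [Fact (1 ≤ p)] :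
    AddGroupSeminorm (Mp P ℱ p) where
  toFun f := (⨆ n, eLpNorm (f.seq n) p P).toReal
  map_zero' := by simp [Mp.seq_zero]
  add_le' f g := by
    have hf := f.iSup_lt_top
    have hg := g.iSup_lt_top
    rw [← ENNReal.toReal_add hf.ne hg.ne]
    refine ENNReal.toReal_mono (ENNReal.add_ne_top.2 ⟨hf.ne, hg.ne⟩) (iSup_le fun n => ?_)
    rw [Mp.seq_add]
    exact (eLpNorm_add_le (f.martingale.integrable n).1 (g.martingale.integrable n).1
      Fact.out).trans (add_le_add (le_iSup (fun n => eLpNorm (f.seq n) p P) n)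
        (le_iSup (fun n => eLpNorm (g.seq n) p P) n))
  neg' f := by simp [Mp.seq_neg, eLpNorm_neg]

/-- `M_p` with the norm `sup_n ‖f_n‖_{L^p}`. Martingales are sequences of genuine functions, so this
is in general a seminorm; it is a norm as soon as no nonempty set of any `ℱ n` is null. -/
instance (P : Measure Ω) (ℱ : Filtration ℕ mΩ) (p : ℝ≥0∞) [Fact (1 ≤ p)] :
    SeminormedAddCommGroup (Mp P ℱ p) :=
  (Mp.seminorm P ℱ p).toSeminormedAddCommGroup

/-- `M_1^u`: the uniformly integrable martingales in `M_1`. -/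
def M1u (P : Measure Ω) (ℱ : Filtration ℕ mΩ) : Set (Mp P ℱ 1) :=
  {f | UniformIntegrable f.seq 1 P}

/-- `M_1^s`: the martingales in `M_1` converging to zero almost surely. -/
def M1s (P : Measure Ω) (ℱ : Filtration ℕ mΩ) : Set (Mp P ℱ 1) :=
  {f | ∀ᵐ ω ∂P, Tendsto (fun n => f.seq n ω) atTop (𝓝 0)}

/-- `limsup f_n(x) = +∞` and `liminf f_n(x) = -∞`, where `f_n(x)` is the value of `f_n` on the
`n`-th cell of `x ∈ K`. -/
def Oscillates {P : Measure Ω} {ℱ : Filtration ℕ mΩ} {p : ℝ≥0∞} [Fact (1 ≤ p)]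
    {D : ℕ → Set (Set Ω)} (f : Mp P ℱ p) (x : InverseLimit D) : Prop :=
  limsup (fun n => (cellValue (f.seq n) (x.cell n) : EReal)) atTop = ⊤ ∧
    liminf (fun n => (cellValue (f.seq n) (x.cell n) : EReal)) atTop = ⊥

/-- For a subspace `Y` of `M_p`: the pairs `(f, x) ∈ Y × K` with strongest possible divergence form
a dense `G_δ` set, and so do, for all `f` in a dense `G_δ` subset of `Y`, the points `x` of a
suitable subset of `K`. -/
def TypicallyOscillates {P : Measure Ω} {ℱ : Filtration ℕ mΩ} {p : ℝ≥0∞} [Fact (1 ≤ p)]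
    (D : ℕ → Set (Set Ω)) (Y : Set (Mp P ℱ p)) : Prop :=
  (Dense {q : Y × InverseLimit D | Oscillates q.1.1 q.2} ∧
    IsGδ {q : Y × InverseLimit D | Oscillates q.1.1 q.2}) ∧
  ∃ A : Set Y, Dense A ∧ IsGδ A ∧ ∀ f ∈ A,
    ∃ B : Set (InverseLimit D), Dense B ∧ IsGδ B ∧ ∀ x ∈ B, Oscillates f.1 x

end PartitionMartingale

end

/-!
The sets `{(f, x) | ∃ n ≥ N, f_n(x) > N}` and `{(f, x) | ∃ n ≥ N, f_n(x) < -N}` are open in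
`Y × K`, because a cell has positive measure, so that the norm of `f` controls the value of `f_n`
on it (`IsSplitting.uniformContinuous_eval`). The set of pairs with oscillation is their
intersection over all `N`. `K` is compact and second countable, and `Y` is a closed subset of the
complete space `M_p` (`IsSplitting.completeSpace`, `isClosed_M1u`, `isClosed_M1s`). Hence, by the
Baire category theorem and the open case of the Kuratowski–Ulam theorem
(`dense_iInter_and_sections`), it remains to see that these open sets are dense.

For this, let a martingale `f`, a cell `d`, a real number `a` and `N` be given. Since cells keep
splitting, for large `n` the cell `d` contains as many cells `d'` of the `n`-th partition as
desired. The `p`-th powers of the `L^p` norms of `(a - f_n) 1_{d'}` add up to at most the `p`-th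
power of `|a| + ‖f‖`, so one of these norms is small (`IsSplitting.exists_subcell_enorm_mul_lt`).
Therefore a martingale `g` which takes the value `a - f_n` on `d'` and whose norm is this small
number is a small perturbation, and `f + g` takes the value `a` on `d'`. If `Y` is `M_p` or
`M_1^u`, let `g` consist of the conditional expectations of `(a - f_n) 1_{d'}`
(`IsSplitting.exists_uniformIntegrable`). If `Y` is `M_1^s`, let `g` be the martingale of a point
mass at a point of `K` below `d'` whose cells have measures tending to zero
(`IsSplitting.exists_mem_M1s`).
-/

noncomputable section

namespace PartitionMartingale

universe u

variable {Ω : Type u} {mΩ : MeasurableSpace Ω}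

/-! ### Cells of a splitting sequence of partitions -/

/-- The standing assumptions: the `σ`-algebras `ℱ n` are generated by finite partitions `D n` into
sets of positive measure, and no cell stays a cell forever. -/
structure IsSplitting (P : Measure Ω) (ℱ : Filtration ℕ mΩ) (D : ℕ → Set (Set Ω)) : Prop where
  finite : ∀ n, (D n).Finite
  isPartition : ∀ n, Setoid.IsPartition (D n)
  gen : ∀ n, ℱ n = MeasurableSpace.generateFrom (D n)
  pos : ∀ n, ∀ d ∈ D n, 0 < P d
  split : ∀ n, ∀ d ∈ D n, ∃ m > n, d ∉ D m

/-- The cell of the `n`-th partition that contains `ω`, written as the union of all such cells. -/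
def cellAt (D : ℕ → Set (Set Ω)) (n : ℕ) (ω : Ω) : Set Ω := ⋃₀ {d ∈ D n | ω ∈ d}

namespace IsSplitting

variable {P : Measure Ω} {ℱ : Filtration ℕ mΩ} {D : ℕ → Set (Set Ω)}

theorem cellAt_eq (H : IsSplitting P ℱ D) {n : ℕ} {d : Set Ω} (hd : d ∈ D n) {ω : Ω}
    (hω : ω ∈ d) : cellAt D n ω = d := by
  have h : {d ∈ D n | ω ∈ d} = {d} := by
    ext e
    refine ⟨fun he => ((H.isPartition n).2 ω).unique he ⟨hd, hω⟩, ?_⟩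
    rintro rfl
    exact ⟨hd, hω⟩
  rw [cellAt, h, Set.sUnion_singleton]

theorem exists_cell (H : IsSplitting P ℱ D) (n : ℕ) (ω : Ω) : ∃ d ∈ D n, ω ∈ d :=
  ((H.isPartition n).2 ω).exists

theorem cellAt_mem (H : IsSplitting P ℱ D) (n : ℕ) (ω : Ω) : cellAt D n ω ∈ D n := by
  obtain ⟨d, hd, hω⟩ := H.exists_cell n ω
  rwa [H.cellAt_eq hd hω]

theorem mem_cellAt (H : IsSplitting P ℱ D) (n : ℕ) (ω : Ω) : ω ∈ cellAt D n ω := by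
  obtain ⟨d, hd, hω⟩ := H.exists_cell n ω
  rwa [H.cellAt_eq hd hω]

theorem cellAt_eq_of_mem (H : IsSplitting P ℱ D) {n : ℕ} {ω ω' : Ω} (h : ω' ∈ cellAt D n ω) :
    cellAt D n ω' = cellAt D n ω :=
  H.cellAt_eq (H.cellAt_mem n ω) h

theorem measurableSet_cell (H : IsSplitting P ℱ D) {n : ℕ} {d : Set Ω} (hd : d ∈ D n) :
    MeasurableSet[ℱ n] d := by
  rw [H.gen n]
  exact MeasurableSpace.measurableSet_generateFrom hd

theorem eval_eq (H : IsSplitting P ℱ D) {n : ℕ} {g : Ω → ℝ} (hg : Measurable[ℱ n] g) {ω ω' : Ω}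
    (h : ω' ∈ cellAt D n ω) : g ω' = g ω := by
  rw [← cellValue_eq (H.isPartition n) (H.gen n) hg (H.cellAt_mem n ω) h,
    ← cellValue_eq (H.isPartition n) (H.gen n) hg (H.cellAt_mem n ω) (H.mem_cellAt n ω)]

/-- The cells are the atoms of `ℱ n`. -/
theorem cellAt_subset (H : IsSplitting P ℱ D) {n : ℕ} {s : Set Ω} (hs : MeasurableSet[ℱ n] s)
    {ω : Ω} (hω : ω ∈ s) : cellAt D n ω ⊆ s := by
  intro ω' h
  have hm : Measurable[ℱ n] (s.indicator (fun _ => (1 : ℝ))) := measurable_const.indicator hs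
  have := H.eval_eq hm h
  by_contra hc
  simp [hω, hc] at this

theorem cellAt_anti (H : IsSplitting P ℱ D) {n m : ℕ} (h : n ≤ m) (ω : Ω) :
    cellAt D m ω ⊆ cellAt D n ω :=
  H.cellAt_subset (ℱ.mono h _ (H.measurableSet_cell (H.cellAt_mem n ω))) (H.mem_cellAt n ω)

theorem cellAt_disjoint (H : IsSplitting P ℱ D) {n : ℕ} {ω ω' : Ω}
    (h : cellAt D n ω ≠ cellAt D n ω') : Disjoint (cellAt D n ω) (cellAt D n ω') := by
  rw [Set.disjoint_left]
  intro v hv hv'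
  exact h ((H.cellAt_eq_of_mem hv).symm.trans (H.cellAt_eq_of_mem hv'))

/-- Every cell contains arbitrarily many cells of some later partition. The subcells are
represented by points. -/
theorem exists_many_subcells (H : IsSplitting P ℱ D) {m : ℕ} {d : Set Ω} (hd : d ∈ D m)
    (N k : ℕ) : ∃ n ≥ N, m ≤ n ∧ ∃ W : Finset Ω, W.card = k ∧ ↑W ⊆ d ∧
      Set.InjOn (cellAt D n) W := by
  classical
  induction k with
  | zero => exact ⟨max N m, le_max_left _ _, le_max_right _ _, ∅, by simp⟩
  | succ k ih =>
    obtain ⟨n, hN, hm, W, hcard, hWd, hinj⟩ := ih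
    rcases W.eq_empty_or_nonempty with rfl | ⟨w, hw⟩
    · have hne : d.Nonempty := Set.nonempty_iff_ne_empty.2
        fun h => (H.isPartition m).1 (h ▸ hd)
      obtain ⟨w, hw⟩ := hne
      simp only [Finset.card_empty] at hcard
      exact ⟨n, hN, hm, {w}, by simp [← hcard], by simpa using hw, by simp⟩
    · obtain ⟨n', hn', hc⟩ := H.split n _ (H.cellAt_mem n w)
      obtain ⟨w', hw', hw''⟩ : ∃ w' ∈ cellAt D n w, w' ∉ cellAt D n' w := by
        by_contra! hcon
        refine hc ?_
        rw [Set.Subset.antisymm hcon (H.cellAt_anti hn'.le w)]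
        exact H.cellAt_mem n' w
      have hup : ∀ v v', cellAt D n' v = cellAt D n' v' → cellAt D n v = cellAt D n v' := by
        intro v v' h
        exact H.cellAt_eq_of_mem (H.cellAt_anti hn'.le v' (h ▸ H.mem_cellAt n' v))
      have hnew : ∀ v ∈ W, cellAt D n' v ≠ cellAt D n' w' := by
        intro v hv h
        have : v = w := hinj hv hw ((hup _ _ h).trans (H.cellAt_eq_of_mem hw'))
        subst this
        exact hw'' (h ▸ H.mem_cellAt n' w')
      have hwW : w' ∉ W := fun h => hnew w' h rfl
      refine ⟨n', hN.le.trans hn'.le, hm.trans hn'.le, insert w' W,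
        by rw [Finset.card_insert_of_notMem hwW, hcard], ?_, ?_⟩
      · rw [Finset.coe_insert, Set.insert_subset_iff]
        refine ⟨?_, hWd⟩
        have := H.cellAt_anti hm w hw'
        rwa [H.cellAt_eq hd (hWd hw)] at this
      · rw [Finset.coe_insert, Set.injOn_insert (by simpa using hwW)]
        refine ⟨fun v hv v' hv' h => hinj hv hv' (hup _ _ h), ?_⟩
        rintro ⟨v, hv, h⟩
        exact hnew v hv h

theorem exists_next_halving (H : IsSplitting P ℱ D) (j : ℕ) (ω : Ω) :
    ∃ ω' ∈ cellAt D j ω, cellAt D (j + 1) ω' = cellAt D j ω ∨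
      P (cellAt D (j + 1) ω') ≤ P (cellAt D j ω) / 2 := by
  by_cases h : cellAt D j ω ⊆ cellAt D (j + 1) ω
  · exact ⟨ω, H.mem_cellAt j ω, Or.inl (Set.Subset.antisymm (H.cellAt_anti j.le_succ ω) h)⟩
  obtain ⟨ω', hω', hn⟩ := Set.not_subset.1 h
  have hsub : cellAt D (j + 1) ω' ⊆ cellAt D j ω :=
    (H.cellAt_anti j.le_succ ω').trans (H.cellAt_eq_of_mem hω').subset
  have hne : cellAt D (j + 1) ω ≠ cellAt D (j + 1) ω' := fun h => hn (h ▸ H.mem_cellAt _ ω')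
  have hsum : P (cellAt D (j + 1) ω) + P (cellAt D (j + 1) ω') ≤ P (cellAt D j ω) := by
    rw [← measure_union (H.cellAt_disjoint hne)
      (ℱ.le _ _ (H.measurableSet_cell (H.cellAt_mem _ _)))]
    exact measure_mono (Set.union_subset (H.cellAt_anti j.le_succ ω) hsub)
  rcases le_total (P (cellAt D (j + 1) ω)) (P (cellAt D (j + 1) ω')) with hle | hle
  · refine ⟨ω, H.mem_cellAt j ω, Or.inr ?_⟩
    rw [ENNReal.le_div_iff_mul_le (by simp) (by simp), mul_two]
    exact le_trans (by gcongr) hsum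
  · refine ⟨ω', hω', Or.inr ?_⟩
    rw [ENNReal.le_div_iff_mul_le (by simp) (by simp), mul_two]
    exact le_trans (by gcongr) hsum

/-- Through every cell there is a decreasing sequence of cells whose measures tend to zero. -/
theorem exists_path_tendsto_zero [IsFiniteMeasure P] (H : IsSplitting P ℱ D) (n : ℕ) (ω : Ω) :
    ∃ e : ℕ → Set Ω, (∀ j, e j ∈ D j) ∧ Antitone e ∧ e n = cellAt D n ω ∧
      Tendsto (fun j => P (e j)) atTop (𝓝 0) := by
  choose next hnext hhalf using H.exists_next_halving
  -- The point stays put up to level `n`, so that the path goes through `cellAt D n ω`.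
  let w : ℕ → Ω := fun j => Nat.rec ω (fun j v => if j < n then v else next j v) j
  have hw : ∀ j, w (j + 1) = if j < n then w j else next j (w j) := fun _ => rfl
  have hw0 : ∀ j ≤ n, w j = ω := by
    intro j
    induction j with
    | zero => intro _; rfl
    | succ j ih => intro hj; rw [hw, if_pos (by omega), ih (by omega)]
  have hmem : ∀ j, w (j + 1) ∈ cellAt D j (w j) := by
    intro j
    rw [hw]
    split_ifs
    · exact H.mem_cellAt j _
    · exact hnext j _
  have hanti : Antitone fun j => cellAt D j (w j) := antitone_nat_of_succ_le fun j =>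
    (H.cellAt_anti j.le_succ _).trans (H.cellAt_eq_of_mem (hmem j)).subset
  refine ⟨fun j => cellAt D j (w j), fun j => H.cellAt_mem j _, hanti, by simp [hw0 n le_rfl], ?_⟩
  have hantiP : Antitone fun j => P (cellAt D j (w j)) := fun i j h => measure_mono (hanti h)
  have hlim := tendsto_atTop_iInf hantiP
  have hle : ∀ j, (⨅ i, P (cellAt D i (w i))) ≤ P (cellAt D j (w j)) := iInf_le _
  have key : ∀ j ≥ n, ∃ m ≥ j, P (cellAt D m (w m)) ≤ P (cellAt D j (w j)) / 2 := by
    intro j hj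
    by_contra! hcon
    have hconst : ∀ m ≥ j, cellAt D m (w m) = cellAt D j (w j) := by
      intro m hm
      induction m, hm using Nat.le_induction with
      | base => rfl
      | succ m hm ih =>
        have hs : w (m + 1) = next m (w m) := by rw [hw, if_neg (by omega)]
        rcases hhalf m (w m) with h | h
        · rw [hs, h, ih]
        · rw [← hs, ih] at h
          exact absurd h (not_le.2 (hcon (m + 1) (by omega)))
    obtain ⟨m, hm, hne⟩ := H.split j _ (H.cellAt_mem j (w j))
    exact hne (hconst m hm.le ▸ H.cellAt_mem m (w m))
  have hzero : (⨅ i, P (cellAt D i (w i))) = 0 := by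
    have h2 : (⨅ i, P (cellAt D i (w i))) ≤ (⨅ i, P (cellAt D i (w i))) / 2 := by
      have hdiv : Tendsto (fun j => P (cellAt D j (w j)) / 2) atTop
          (𝓝 ((⨅ i, P (cellAt D i (w i))) / 2)) := ENNReal.Tendsto.div_const hlim (by simp)
      refine ge_of_tendsto hdiv (eventually_atTop.2 ⟨n, fun j hj => ?_⟩)
      obtain ⟨m, _, hm⟩ := key j hj
      exact (hle m).trans hm
    by_contra h0
    exact absurd h2 (not_le.2 (ENNReal.half_lt_self h0
      (ne_top_of_le_ne_top (measure_ne_top P _) (hle 0))))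
  rwa [hzero] at hlim

/-! ### The inverse limit -/

/-- The point of the inverse limit given by the cells around a point of `Ω`. -/
def toLimit (H : IsSplitting P ℱ D) (ω : Ω) : InverseLimit D :=
  ⟨fun n => ⟨cellAt D n ω, H.cellAt_mem n ω⟩, fun _ _ h => H.cellAt_anti h ω⟩

theorem exists_mem_cell (H : IsSplitting P ℱ D) (x : InverseLimit D) (n : ℕ) :
    ∃ ω, x.cell n = cellAt D n ω := by
  have hx : x.cell n ∈ D n := (x.1 n).2
  obtain ⟨ω, hω⟩ : (x.cell n).Nonempty := Set.nonempty_iff_ne_empty.2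
    fun h => (H.isPartition n).1 (h ▸ hx)
  exact ⟨ω, (H.cellAt_eq hx hω).symm⟩

theorem cellValue_cellAt (H : IsSplitting P ℱ D) {n : ℕ} {g : Ω → ℝ} (hg : Measurable[ℱ n] g)
    (ω : Ω) : cellValue g (cellAt D n ω) = g ω :=
  cellValue_eq (H.isPartition n) (H.gen n) hg (H.cellAt_mem n ω) (H.mem_cellAt n ω)

theorem isOpen_cell_eq (x : InverseLimit D) (n : ℕ) :
    IsOpen {y : InverseLimit D | y.cell n = x.cell n} := by
  have hc : Continuous fun y : InverseLimit D => y.1 n :=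
    (continuous_apply n).comp continuous_subtype_val
  have : {y : InverseLimit D | y.cell n = x.cell n} = (fun y => y.1 n) ⁻¹' {x.1 n} := by
    ext y
    exact Subtype.ext_iff.symm
  rw [this]
  exact (isOpen_discrete _).preimage hc

/-- The sets of points with a given `n`-th cell form a neighbourhood basis. -/
theorem exists_cell_eq_subset (H : IsSplitting P ℱ D) {U : Set (InverseLimit D)} (hU : IsOpen U)
    {x : InverseLimit D} (hx : x ∈ U) : ∃ n, ∀ y : InverseLimit D, y.cell n = x.cell n → y ∈ U := by
  obtain ⟨V, hV, rfl⟩ := isOpen_induced_iff.1 hU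
  obtain ⟨I, u, hu, hsub⟩ := isOpen_pi_iff.1 hV _ hx
  refine ⟨I.sup id, fun y hy => hsub fun i hi => ?_⟩
  have hi' : i ≤ I.sup id := Finset.le_sup (f := id) hi
  obtain ⟨ω, hω⟩ := H.exists_mem_cell x (I.sup id)
  have hx' : ω ∈ x.cell (I.sup id) := hω ▸ H.mem_cellAt _ ω
  have hmx : ω ∈ x.cell i := x.2 i _ hi' hx'
  have hmy : ω ∈ y.cell i := y.2 i _ hi' (hy.symm ▸ hx' : ω ∈ y.cell (I.sup id))
  have : y.1 i = x.1 i := Subtype.ext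
    ((H.cellAt_eq (y.1 i).2 hmy).symm.trans (H.cellAt_eq (x.1 i).2 hmx))
  change y.1 i ∈ u i
  rw [this]
  exact (hu i hi).2

theorem secondCountable (H : IsSplitting P ℱ D) : SecondCountableTopology (InverseLimit D) := by
  have : ∀ n, Finite (Cell D n) := fun n => (H.finite n).to_subtype
  have : SecondCountableTopology ((n : ℕ) → Cell D n) := inferInstance
  exact TopologicalSpace.Subtype.secondCountableTopology _

theorem baireSpace (H : IsSplitting P ℱ D) : BaireSpace (InverseLimit D) := by
  have : ∀ n, Finite (Cell D n) := fun n => (H.finite n).to_subtype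
  have hclosed : IsClosed {x : (n : ℕ) → Cell D n | ∀ n m : ℕ, n ≤ m → (x m).1 ⊆ (x n).1} := by
    simp only [Set.ofPred_forall]
    refine isClosed_iInter fun n => isClosed_iInter fun m => isClosed_iInter fun _ => ?_
    exact (isClosed_discrete {q : Cell D m × Cell D n | q.1.1 ⊆ q.2.1}).preimage
      ((continuous_apply m).prodMk (continuous_apply n))
  have : CompactSpace {x : (n : ℕ) → Cell D n // ∀ n m : ℕ, n ≤ m → (x m).1 ⊆ (x n).1} :=
    isCompact_iff_compactSpace.1 hclosed.isCompact
  exact inferInstanceAs (BaireSpace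
    {x : (n : ℕ) → Cell D n // ∀ n m : ℕ, n ≤ m → (x m).1 ⊆ (x n).1})

end IsSplitting

/-! ### The spaces of martingales -/

variable {P : Measure Ω} {ℱ : Filtration ℕ mΩ} {p : ℝ≥0∞} [Fact (1 ≤ p)]

namespace Mp

theorem seq_sub (f g : Mp P ℱ p) (n : ℕ) : (f - g).seq n = f.seq n - g.seq n := rfl

theorem norm_def (f : Mp P ℱ p) : ‖f‖ = (⨆ n, eLpNorm (f.seq n) p P).toReal := rfl

theorem eLpNorm_seq_le (f : Mp P ℱ p) (n : ℕ) : eLpNorm (f.seq n) p P ≤ ENNReal.ofReal ‖f‖ := by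
  rw [norm_def, ENNReal.ofReal_toReal f.iSup_lt_top.ne]
  exact le_iSup (fun n => eLpNorm (f.seq n) p P) n

theorem norm_le {f : Mp P ℱ p} {C : ℝ} (hC : 0 ≤ C)
    (h : ∀ n, eLpNorm (f.seq n) p P ≤ ENNReal.ofReal C) : ‖f‖ ≤ C := by
  rw [norm_def]
  exact ENNReal.toReal_le_of_le_ofReal hC (iSup_le h)

/-- A martingale with a uniform `L^p` bound, as an element of `M_p`. -/
def ofMartingale (f : ℕ → Ω → ℝ) (hf : Martingale f ℱ P) (C : ℝ)
    (hC : ∀ n, eLpNorm (f n) p P ≤ ENNReal.ofReal C) : Mp P ℱ p :=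
  ⟨f, hf, (iSup_le hC).trans_lt ENNReal.ofReal_lt_top⟩

theorem measurable_seq (f : Mp P ℱ p) (n : ℕ) : Measurable[ℱ n] (f.seq n) :=
  (f.martingale.stronglyMeasurable n).measurable

theorem aestronglyMeasurable_seq (f : Mp P ℱ p) (n : ℕ) : AEStronglyMeasurable (f.seq n) P :=
  (f.martingale.integrable n).1

theorem exponent_ne_zero : p ≠ 0 := (zero_lt_one.trans_le (Fact.out : 1 ≤ p)).ne'

end Mp

variable {D : ℕ → Set (Set Ω)}

/-- A cell has positive measure, so the `L^p` norm controls the value there. -/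
theorem IsSplitting.enorm_mul_le (H : IsSplitting P ℱ D) (hp : p ≠ ∞) {n : ℕ} {g : Ω → ℝ}
    (hg : Measurable[ℱ n] g) (ω : Ω) :
    ‖g ω‖ₑ * P (cellAt D n ω) ^ (1 / p.toReal) ≤ eLpNorm g p P := by
  rw [← eLpNorm_indicator_const (ℱ.le n _ (H.measurableSet_cell (H.cellAt_mem n ω)))
    Mp.exponent_ne_zero hp]
  refine eLpNorm_mono fun ω' => ?_
  by_cases h : ω' ∈ cellAt D n ω
  · simp [h, H.eval_eq hg h]
  · simp [h]

theorem IsSplitting.uniformContinuous_eval [IsFiniteMeasure P] (H : IsSplitting P ℱ D) (hp : p ≠ ∞)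
    (n : ℕ) (ω : Ω) : UniformContinuous fun f : Mp P ℱ p => f.seq n ω := by
  let c : ℝ := (P (cellAt D n ω) ^ (1 / p.toReal)).toReal
  have hfin : P (cellAt D n ω) ^ (1 / p.toReal) ≠ ∞ :=
    ENNReal.rpow_ne_top_of_nonneg (by positivity) (measure_ne_top P _)
  have hc : 0 < c := ENNReal.toReal_pos
    (ENNReal.rpow_pos (H.pos n _ (H.cellAt_mem n ω)) (measure_ne_top P _)).ne' hfin
  let φ : Mp P ℱ p →+ ℝ :=
    { toFun := fun f => f.seq n ω, map_zero' := rfl, map_add' := fun _ _ => rfl }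
  refine AddMonoidHomClass.uniformContinuous_of_bound φ c⁻¹ fun f => ?_
  have h := (H.enorm_mul_le hp (f.measurable_seq n) ω).trans (f.eLpNorm_seq_le n)
  have h2 := ENNReal.toReal_mono ENNReal.ofReal_ne_top h
  rw [ENNReal.toReal_mul, ENNReal.toReal_ofReal (norm_nonneg f), toReal_enorm] at h2
  rw [inv_mul_eq_div, le_div_iff₀ hc]
  exact h2

/-- The spaces `M_p` are complete: evaluation at a point is continuous, so Cauchy sequences
converge pointwise, and Fatou's lemma turns this into convergence in norm. -/
theorem IsSplitting.completeSpace [IsProbabilityMeasure P] (H : IsSplitting P ℱ D) (hp : p ≠ ∞) :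
    CompleteSpace (Mp P ℱ p) := by
  refine Metric.complete_of_cauchySeq_tendsto fun u hu => ?_
  have hlim : ∀ n ω, ∃ l, Tendsto (fun k => (u k).seq n ω) atTop (𝓝 l) := fun n ω =>
    cauchySeq_tendsto_of_complete (hu.map (H.uniformContinuous_eval hp n ω))
  choose F hF using hlim
  have hFm : ∀ n, StronglyMeasurable[ℱ n] (F n) := fun n =>
    stronglyMeasurable_of_tendsto atTop
      (fun k => (u k).martingale.stronglyMeasurable n) (tendsto_pi_nhds.2 fun ω => hF n ω)
  have hconv : ∀ ε > 0, ∃ K, ∀ k ≥ K, ∀ n,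
      eLpNorm ((u k).seq n - F n) p P ≤ ENNReal.ofReal ε := by
    intro ε hε
    obtain ⟨K, hK⟩ := Metric.cauchySeq_iff.1 hu ε hε
    refine ⟨K, fun k hk n => ?_⟩
    have hfatou := Lp.eLpNorm_lim_le_liminf_eLpNorm (p := p) (μ := P)
      (f := fun j => (u k).seq n - (u j).seq n)
      (fun j => ((u k).aestronglyMeasurable_seq n).sub ((u j).aestronglyMeasurable_seq n))
      ((u k).seq n - F n) (ae_of_all _ fun ω => (hF n ω).const_sub _)
    refine hfatou.trans (liminf_le_of_frequently_le' (Eventually.frequently ?_))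
    filter_upwards [eventually_ge_atTop K] with j hj
    rw [← Mp.seq_sub]
    refine (Mp.eLpNorm_seq_le _ n).trans (ENNReal.ofReal_le_ofReal ?_)
    rw [← dist_eq_norm]
    exact (hK k hk j hj).le
  have hFae : ∀ n, AEStronglyMeasurable (F n) P := fun n =>
    ((hFm n).mono (ℱ.le n)).aestronglyMeasurable
  obtain ⟨K, hK⟩ := hconv 1 one_pos
  have hbound : ∀ n, eLpNorm (F n) p P ≤ ENNReal.ofReal (‖u K‖ + 1) := by
    intro n
    have : F n = (u K).seq n - ((u K).seq n - F n) := by simp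
    rw [this, ENNReal.ofReal_add (norm_nonneg _) zero_le_one]
    exact (eLpNorm_sub_le ((u K).aestronglyMeasurable_seq n)
      (((u K).aestronglyMeasurable_seq n).sub (hFae n)) Fact.out).trans
      (add_le_add ((u K).eLpNorm_seq_le n) (hK K le_rfl n))
  have hint : ∀ n, Integrable (F n) P := fun n =>
    MemLp.integrable (Fact.out : 1 ≤ p) ⟨hFae n, (hbound n).trans_lt ENNReal.ofReal_lt_top⟩
  have hL1 : ∀ n, Tendsto (fun k => eLpNorm ((u k).seq n - F n) 1 P) atTop (𝓝 0) := by
    intro n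
    rw [ENNReal.tendsto_atTop_zero]
    intro ε hε
    obtain ⟨δ, hδ, hδε⟩ : ∃ δ : ℝ, 0 < δ ∧ ENNReal.ofReal δ ≤ ε := by
      rcases eq_or_ne ε ∞ with rfl | hne
      · exact ⟨1, one_pos, le_top⟩
      · exact ⟨ε.toReal, ENNReal.toReal_pos hε.ne' hne, ENNReal.ofReal_toReal_le⟩
    obtain ⟨K, hK⟩ := hconv δ hδ
    exact ⟨K, fun k hk => (eLpNorm_le_eLpNorm_of_exponent_le Fact.out
      (((u k).aestronglyMeasurable_seq n).sub (hFae n))).trans ((hK k hk n).trans hδε)⟩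
  have hmart : Martingale F ℱ P := by
    refine martingale_of_setIntegral_eq_succ hFm hint fun i s hs => ?_
    have ht : ∀ n, Tendsto (fun k => ∫ ω in s, (u k).seq n ω ∂P) atTop
        (𝓝 (∫ ω in s, F n ω ∂P)) := fun n =>
      tendsto_setIntegral_of_L1' (F n) (hFae n)
        (Eventually.of_forall fun k => (u k).martingale.integrable n) (hL1 n) s
    refine tendsto_nhds_unique (ht i) ((ht (i + 1)).congr fun k => ?_)
    exact ((u k).martingale.setIntegral_eq i.le_succ hs).symm
  obtain ⟨G, hG⟩ : ∃ G : Mp P ℱ p, G.seq = F := ⟨Mp.ofMartingale F hmart _ hbound, rfl⟩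
  refine ⟨G, Metric.tendsto_atTop.2 fun ε hε => ?_⟩
  obtain ⟨K, hK⟩ := hconv (ε / 2) (half_pos hε)
  refine ⟨K, fun k hk => ?_⟩
  rw [dist_eq_norm]
  refine (Mp.norm_le (half_pos hε).le fun n => ?_).trans_lt (half_lt_self hε)
  rw [Mp.seq_sub, hG]
  exact hK k hk n

theorem mem_M1u_iff {f : Mp P ℱ 1} : f ∈ M1u P ℱ ↔ UnifIntegrable f.seq 1 P :=
  ⟨fun h => h.2.1, fun h => ⟨f.aestronglyMeasurable_seq, h, ‖f‖.toNNReal, f.eLpNorm_seq_le⟩⟩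

theorem add_mem_M1u {f g : Mp P ℱ 1} (hf : f ∈ M1u P ℱ) (hg : g ∈ M1u P ℱ) :
    f + g ∈ M1u P ℱ := by
  rw [mem_M1u_iff] at *
  exact hf.add hg le_rfl f.aestronglyMeasurable_seq g.aestronglyMeasurable_seq

theorem isClosed_M1u : IsClosed (M1u P ℱ) := by
  refine isClosed_of_closure_subset fun f hf => ?_
  rw [mem_M1u_iff]
  intro ε hε
  obtain ⟨g, hg, hfg⟩ := Metric.mem_closure_iff.1 hf (ε / 2) (half_pos hε)
  obtain ⟨δ, hδ, h⟩ := hg.2.1 (half_pos hε)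
  refine ⟨δ, hδ, fun i s hs hPs => ?_⟩
  have heq : s.indicator (f.seq i) = s.indicator ((f - g).seq i) + s.indicator (g.seq i) := by
    rw [← Set.indicator_add', Mp.seq_sub, sub_add_cancel]
  rw [heq, ← add_halves ε, ENNReal.ofReal_add (half_pos hε).le (half_pos hε).le]
  refine (eLpNorm_add_le (((f - g).aestronglyMeasurable_seq i).indicator hs)
    ((g.aestronglyMeasurable_seq i).indicator hs) le_rfl).trans (add_le_add ?_ (h i s hs hPs))
  refine (eLpNorm_indicator_le _).trans (((f - g).eLpNorm_seq_le i).trans ?_)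
  rw [← dist_eq_norm]
  exact ENNReal.ofReal_le_ofReal hfg.le

theorem add_mem_M1s {f g : Mp P ℱ 1} (hf : f ∈ M1s P ℱ) (hg : g ∈ M1s P ℱ) :
    f + g ∈ M1s P ℱ := by
  have h : ∀ᵐ ω ∂P, Tendsto (fun n => f.seq n ω + g.seq n ω) atTop (𝓝 (0 + 0)) := by
    filter_upwards [hf, hg] with ω h1 h2 using h1.add h2
  rwa [add_zero] at h

/-- By Fatou's lemma the `L^1` norm of the almost sure limit of a martingale is at most the norm of
the martingale; adding an element of `M_1^s` does not change that limit. -/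
theorem isClosed_M1s [IsFiniteMeasure P] : IsClosed (M1s P ℱ) := by
  refine isClosed_of_closure_subset fun f hf => ?_
  obtain ⟨l, hlm, hconv⟩ := measurable_limit_of_tendsto_metrizable_ae
    (fun n => (f.aestronglyMeasurable_seq n).aemeasurable)
    (f.martingale.submartingale.exists_ae_tendsto_of_bdd (R := ‖f‖.toNNReal) f.eLpNorm_seq_le)
  have hm : AEStronglyMeasurable l P := hlm.aestronglyMeasurable
  have hzero : eLpNorm l 1 P ≤ 0 := by
    refine ENNReal.le_of_forall_pos_le_add fun ε hε _ => ?_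
    obtain ⟨g, hg, hfg⟩ := Metric.mem_closure_iff.1 hf ε hε
    have hfatou := Lp.eLpNorm_lim_le_liminf_eLpNorm (p := 1) (μ := P) (f := (f - g).seq)
      (f - g).aestronglyMeasurable_seq l (by
        filter_upwards [hconv, hg] with ω h1 h2
        have := h1.sub h2
        rwa [sub_zero] at this)
    rw [zero_add]
    refine hfatou.trans (liminf_le_of_frequently_le' (Frequently.of_forall fun n => ?_))
    refine ((f - g).eLpNorm_seq_le n).trans ?_
    rw [← dist_eq_norm, ← ENNReal.ofReal_coe_nnreal]
    exact ENNReal.ofReal_le_ofReal hfg.le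
  rw [nonpos_iff_eq_zero, eLpNorm_eq_zero_iff hm one_ne_zero] at hzero
  filter_upwards [hconv, hzero] with ω h1 h2
  rwa [h2] at h1

/-! ### Small perturbations with a prescribed value -/

/-- The `p`-th powers of the `L^p` norms of `a - f_n` on disjoint cells add up to at most a
constant, so among sufficiently many subcells of a given cell there is one on which the norm is
small: changing the value of `f_n` to `a` there is cheap. -/
theorem IsSplitting.exists_subcell_enorm_mul_lt [IsProbabilityMeasure P] (H : IsSplitting P ℱ D)
    (hp : p ≠ ∞) (f : Mp P ℱ p) (m : ℕ) (ω₀ : Ω) (N : ℕ) (a : ℝ) {ε : ℝ} (hε : 0 < ε) :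
    ∃ n ≥ N, ∃ ω ∈ cellAt D m ω₀,
      ‖a - f.seq n ω‖ₑ * P (cellAt D n ω) ^ (1 / p.toReal) < ENNReal.ofReal ε := by
  by_contra! hcon
  have hp0 : p ≠ 0 := Mp.exponent_ne_zero
  have hq : 0 < p.toReal := ENNReal.toReal_pos hp0 hp
  let M : ℝ≥0∞ := eLpNorm (fun _ : Ω => a) p P + ENNReal.ofReal ‖f‖
  have hM : M ≠ ∞ := ENNReal.add_ne_top.2 ⟨(memLp_const a).2.ne, ENNReal.ofReal_ne_top⟩
  obtain ⟨k, hk⟩ := ENNReal.exists_nat_mul_gt (a := ENNReal.ofReal ε ^ p.toReal)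
    (b := M ^ p.toReal)
    (ENNReal.rpow_pos (ENNReal.ofReal_pos.2 hε) ENNReal.ofReal_ne_top).ne'
    (ENNReal.rpow_ne_top_of_nonneg hq.le hM)
  obtain ⟨n, hN, -, W, hcard, hW, hinj⟩ := H.exists_many_subcells (H.cellAt_mem m ω₀) N k
  have hcell : ∀ w, MeasurableSet (cellAt D n w) := fun w =>
    ℱ.le n _ (H.measurableSet_cell (H.cellAt_mem n w))
  let g : Ω → ℝ := fun ω => a - f.seq n ω
  have hgm : Measurable[ℱ n] g := (f.measurable_seq n).const_sub a
  have hgM : eLpNorm g p P ≤ M := (eLpNorm_sub_le aestronglyMeasurable_const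
    (f.aestronglyMeasurable_seq n) Fact.out).trans (add_le_add le_rfl (f.eLpNorm_seq_le n))
  have hterm : ∀ w ∈ W, ENNReal.ofReal ε ^ p.toReal ≤
      ∫⁻ ω in cellAt D n w, ‖g ω‖ₑ ^ p.toReal ∂P := by
    intro w hw
    have hconst : ∫⁻ ω in cellAt D n w, ‖g ω‖ₑ ^ p.toReal ∂P =
        ∫⁻ _ in cellAt D n w, ‖g w‖ₑ ^ p.toReal ∂P :=
      setLIntegral_congr_fun (hcell w) fun ω hω => by simp only [H.eval_eq hgm hω]
    rw [hconst, setLIntegral_const]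
    refine (ENNReal.rpow_le_rpow (hcon n hN w (hW hw)) hq.le).trans_eq ?_
    rw [ENNReal.mul_rpow_of_nonneg _ _ hq.le, ← ENNReal.rpow_mul, one_div_mul_cancel hq.ne',
      ENNReal.rpow_one]
  have hsum : (k : ℝ≥0∞) * ENNReal.ofReal ε ^ p.toReal ≤ M ^ p.toReal := calc
    (k : ℝ≥0∞) * ENNReal.ofReal ε ^ p.toReal = ∑ w ∈ W, ENNReal.ofReal ε ^ p.toReal := by
      rw [Finset.sum_const, hcard, nsmul_eq_mul]
    _ ≤ ∑ w ∈ W, ∫⁻ ω in cellAt D n w, ‖g ω‖ₑ ^ p.toReal ∂P := Finset.sum_le_sum hterm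
    _ = ∫⁻ ω in ⋃ w ∈ W, cellAt D n w, ‖g ω‖ₑ ^ p.toReal ∂P :=
      (lintegral_biUnion_finset (fun v hv w hw hvw => H.cellAt_disjoint
        fun h => hvw (hinj hv hw h)) (fun w _ => hcell w) _).symm
    _ ≤ ∫⁻ ω, ‖g ω‖ₑ ^ p.toReal ∂P := setLIntegral_le_lintegral _ _
    _ = eLpNorm g p P ^ p.toReal := by
      rw [eLpNorm_eq_lintegral_rpow_enorm_toReal hp0 hp, ← ENNReal.rpow_mul,
        one_div_mul_cancel hq.ne', ENNReal.rpow_one]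
    _ ≤ M ^ p.toReal := ENNReal.rpow_le_rpow hgM hq.le
  exact absurd hk (not_lt.2 hsum)

/-- The perturbation is the martingale of conditional expectations of a multiple of the indicator
function of the cell, and conditional expectation does not increase `L^p` norms. -/
theorem IsSplitting.exists_uniformIntegrable [IsProbabilityMeasure P] (H : IsSplitting P ℱ D)
    (hp : p ≠ ∞) (n : ℕ) (ω : Ω) (c : ℝ) {ε : ℝ} (hε : 0 ≤ ε)
    (hc : ‖c‖ₑ * P (cellAt D n ω) ^ (1 / p.toReal) ≤ ENNReal.ofReal ε) :
    ∃ g : Mp P ℱ p, g.seq n ω = c ∧ ‖g‖ ≤ ε ∧ UniformIntegrable g.seq 1 P := by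
  have hcell := H.measurableSet_cell (H.cellAt_mem n ω)
  let h : Ω → ℝ := (cellAt D n ω).indicator fun _ => c
  have hm : StronglyMeasurable[ℱ n] h := stronglyMeasurable_const.indicator hcell
  have hint : Integrable h P := (integrable_const c).indicator (ℱ.le n _ hcell)
  have hbound : ∀ k, eLpNorm (P[h | ℱ k]) p P ≤ ENNReal.ofReal ε := fun k =>
    (eLpNorm_condExp_le_eLpNorm h Fact.out).trans
      (by rwa [eLpNorm_indicator_const (ℱ.le n _ hcell) Mp.exponent_ne_zero hp])
  obtain ⟨g, hg⟩ : ∃ g : Mp P ℱ p, g.seq = fun k => P[h | ℱ k] :=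
    ⟨Mp.ofMartingale _ (martingale_condExp h ℱ P) _ hbound, rfl⟩
  refine ⟨g, ?_, Mp.norm_le hε fun k => ?_, ?_⟩
  · rw [hg]
    change (P[h | ℱ n]) ω = c
    rw [condExp_of_stronglyMeasurable (ℱ.le n) hm hint]
    exact Set.indicator_of_mem (H.mem_cellAt n ω) _
  · rw [hg]
    exact hbound k
  · rw [hg]
    exact hint.uniformIntegrable_condExp ℱ.le

/-- The martingale whose mass `b` sits on the cells `e n`. It is the martingale of densities of `b`
times the Dirac measure at the point `(e n)` of the inverse limit. -/
theorem IsSplitting.martingale_indicator [IsFiniteMeasure P] (H : IsSplitting P ℱ D)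
    {e : ℕ → Set Ω} (he : ∀ n, e n ∈ D n) (hanti : Antitone e) (b : ℝ) :
    Martingale (fun n => (e n).indicator fun _ => b / P.real (e n)) ℱ P := by
  have hme : ∀ n, MeasurableSet[ℱ n] (e n) := fun n => H.measurableSet_cell (he n)
  have hpos : ∀ n, P.real (e n) ≠ 0 := fun n =>
    (ENNReal.toReal_pos (H.pos n _ (he n)).ne' (measure_ne_top P _)).ne'
  have hint : ∀ n (s : Set Ω),
      ∫ ω in s, (e n).indicator (fun _ => b / P.real (e n)) ω ∂P =
        P.real (s ∩ e n) * (b / P.real (e n)) := by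
    intro n s
    rw [setIntegral_indicator (ℱ.le n _ (hme n)), setIntegral_const, smul_eq_mul]
  refine martingale_of_setIntegral_eq_succ
    (fun n => stronglyMeasurable_const.indicator (hme n))
    (fun n => (integrable_const _).indicator (ℱ.le n _ (hme n))) fun i s hs => ?_
  rw [hint, hint]
  have hsucc := hanti i.le_succ
  -- A set in `ℱ i` contains the atom `e i` or is disjoint from it.
  by_cases hd : Disjoint s (e i)
  · rw [hd.inter_eq, (hd.mono_right hsucc).inter_eq]
    simp
  · obtain ⟨ω, hωs, hωe⟩ := Set.not_disjoint_iff.1 hd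
    have hsub : e i ⊆ s := H.cellAt_eq (he i) hωe ▸ H.cellAt_subset hs hωs
    rw [Set.inter_eq_self_of_subset_right hsub,
      Set.inter_eq_self_of_subset_right (hsucc.trans hsub), mul_div_cancel₀ _ (hpos i),
      mul_div_cancel₀ _ (hpos (i + 1))]

/-- The singular counterpart of `IsSplitting.exists_uniformIntegrable`: the mass of the perturbation
is carried by a single point of the inverse limit whose cells shrink to a null set. -/
theorem IsSplitting.exists_mem_M1s [IsProbabilityMeasure P] (H : IsSplitting P ℱ D)
    (n : ℕ) (ω : Ω) (c : ℝ) {ε : ℝ} (hε : 0 ≤ ε)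
    (hc : ‖c‖ₑ * P (cellAt D n ω) ≤ ENNReal.ofReal ε) :
    ∃ g ∈ M1s P ℱ, g.seq n ω = c ∧ ‖g‖ ≤ ε := by
  obtain ⟨e, he, hanti, hen, hlim⟩ := H.exists_path_tendsto_zero n ω
  have hreal : ∀ k, 0 < P.real (e k) := fun k =>
    ENNReal.toReal_pos (H.pos k _ (he k)).ne' (measure_ne_top P _)
  let b : ℝ := c * P.real (e n)
  have hbound : ∀ k, eLpNorm ((e k).indicator fun _ => b / P.real (e k)) 1 P ≤
      ENNReal.ofReal ε := by
    intro k
    rw [eLpNorm_indicator_const (ℱ.le k _ (H.measurableSet_cell (he k))) one_ne_zero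
      ENNReal.one_ne_top]
    refine le_trans (le_of_eq ?_) hc
    rw [ENNReal.toReal_one, div_one, ENNReal.rpow_one, ← hen, ← ofReal_measureReal (s := e k),
      ← ofReal_measureReal (s := e n), ← ofReal_norm, ← ofReal_norm,
      ← ENNReal.ofReal_mul (norm_nonneg _), ← ENNReal.ofReal_mul (norm_nonneg _), norm_div,
      norm_mul, Real.norm_of_nonneg (hreal k).le, Real.norm_of_nonneg (hreal n).le,
      div_mul_cancel₀ _ (hreal k).ne']
  obtain ⟨g, hg⟩ : ∃ g : Mp P ℱ 1,
      g.seq = fun k => (e k).indicator fun _ => b / P.real (e k) :=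
    ⟨Mp.ofMartingale _ (H.martingale_indicator he hanti b) _ hbound, rfl⟩
  refine ⟨g, ?_, ?_, Mp.norm_le hε fun k => ?_⟩
  · have hnull : P (⋂ k, e k) = 0 := le_antisymm
      (ge_of_tendsto' hlim fun k => measure_mono (Set.iInter_subset e k)) zero_le
    have hae : ∀ᵐ v ∂P, v ∉ ⋂ k, e k := measure_eq_zero_iff_ae_notMem.1 hnull
    change ∀ᵐ v ∂P, Tendsto (fun k => g.seq k v) atTop (𝓝 0)
    filter_upwards [hae] with v hv
    obtain ⟨j, hj⟩ : ∃ j, v ∉ e j := by simpa using hv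
    refine tendsto_const_nhds.congr' ?_
    filter_upwards [eventually_ge_atTop j] with k hk
    rw [hg]
    exact (Set.indicator_of_notMem (fun h => hj (hanti hk h)) _).symm
  · rw [hg]
    change (e n).indicator (fun _ => b / P.real (e n)) ω = c
    rw [Set.indicator_of_mem (hen ▸ H.mem_cellAt n ω), mul_div_cancel_right₀ _ (hreal n).ne']
  · rw [hg]
    exact hbound k

/-! ### Sections of dense open sets -/

section KuratowskiUlam

variable {Y K : Type*} [TopologicalSpace Y] [TopologicalSpace K]

/-- The open case of the Kuratowski–Ulam theorem: for most `y`, the section at `y` meets every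
member of a countable basis of `K`. -/
theorem exists_isGδ_dense_section [BaireSpace Y] [SecondCountableTopology K] {U : Set (Y × K)}
    (hU : IsOpen U) (hd : Dense U) :
    ∃ A : Set Y, IsGδ A ∧ Dense A ∧ ∀ y ∈ A, Dense {x | (y, x) ∈ U} := by
  let b := TopologicalSpace.countableBasis K
  have hb := TopologicalSpace.isBasis_countableBasis K
  have hbc : Countable b := (TopologicalSpace.countable_countableBasis K).to_subtype
  let A : b → Set Y := fun V => Prod.fst '' (U ∩ Prod.snd ⁻¹' V.1)
  have hAo : ∀ V, IsOpen (A V) := fun V =>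
    isOpenMap_fst _ (hU.inter ((hb.isOpen V.2).preimage continuous_snd))
  have hAd : ∀ V, Dense (A V) := by
    intro V
    rw [dense_iff_inter_open]
    rintro O hO ⟨y, hy⟩
    obtain ⟨x, hx⟩ := TopologicalSpace.nonempty_of_mem_countableBasis V.2
    obtain ⟨q, ⟨hqO, hqV⟩, hqU⟩ := hd.inter_open_nonempty (O ×ˢ V.1)
      (hO.prod (hb.isOpen V.2)) ⟨(y, x), hy, hx⟩
    exact ⟨q.1, hqO, q, ⟨hqU, hqV⟩, rfl⟩
  refine ⟨⋂ V, A V, IsGδ.iInter_of_isOpen hAo, dense_iInter_of_isOpen hAo hAd, fun y hy => ?_⟩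
  rw [hb.dense_iff]
  intro V hV _
  obtain ⟨q, ⟨hqU, hqV⟩, rfl⟩ := Set.mem_iInter.1 hy ⟨V, hV⟩
  exact ⟨q.2, hqV, hqU⟩

theorem dense_iInter_and_sections [BaireSpace Y] [BaireSpace K] [SecondCountableTopology K]
    {ι : Type*} [Countable ι] {U : ι → Set (Y × K)} (hU : ∀ i, IsOpen (U i))
    (hd : ∀ i, Dense (U i)) :
    Dense (⋂ i, U i) ∧ ∃ A : Set Y, Dense A ∧ IsGδ A ∧
      ∀ y ∈ A, ∃ B : Set K, Dense B ∧ IsGδ B ∧ ∀ x ∈ B, (y, x) ∈ ⋂ i, U i := by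
  choose A hAG hAd hA using fun i => exists_isGδ_dense_section (hU i) (hd i)
  have hsec : ∀ i y, IsOpen {x | (y, x) ∈ U i} := fun i y =>
    (hU i).preimage (Continuous.prodMk_right y)
  have hAdense : Dense (⋂ i, A i) := dense_iInter_of_Gδ hAG hAd
  have hB : ∀ y ∈ ⋂ i, A i, Dense (⋂ i, {x | (y, x) ∈ U i}) := fun y hy =>
    dense_iInter_of_isOpen (fun i => hsec i y) fun i => hA i y (Set.mem_iInter.1 hy i)
  refine ⟨?_, ⋂ i, A i, hAdense, IsGδ.iInter hAG, fun y hy => ⟨_, hB y hy,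
    IsGδ.iInter_of_isOpen fun i => hsec i y, fun x hx => ?_⟩⟩
  · rw [dense_iff_inter_open]
    rintro O hO ⟨⟨y, x⟩, hyx⟩
    obtain ⟨S, T, hS, hT, hyS, hxT, hST⟩ := isOpen_prod_iff.1 hO y x hyx
    obtain ⟨y', hy'S, hy'A⟩ := hAdense.inter_open_nonempty S hS ⟨y, hyS⟩
    obtain ⟨x', hx'T, hx'⟩ := (hB y' hy'A).inter_open_nonempty T hT ⟨x, hxT⟩
    exact ⟨(y', x'), hST ⟨hy'S, hx'T⟩, Set.mem_iInter.2 fun i => Set.mem_iInter.1 hx' i⟩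
  · exact Set.mem_iInter.2 fun i => Set.mem_iInter.1 hx i

end KuratowskiUlam

/-! ### Oscillation -/

theorem limsup_coe_eq_top_iff (u : ℕ → ℝ) :
    limsup (fun n => (u n : EReal)) atTop = ⊤ ↔ ∀ N : ℕ, ∃ n ≥ N, (N : ℝ) < u n := by
  constructor
  · intro h N
    have hlt : ((N : ℝ) : EReal) < limsup (fun n => (u n : EReal)) atTop := by
      rw [h]
      exact EReal.coe_lt_top _
    obtain ⟨n, hn, hu⟩ := frequently_atTop.1 (frequently_lt_of_lt_limsup (by isBoundedDefault) hlt) N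
    exact ⟨n, hn, EReal.coe_lt_coe_iff.1 hu⟩
  · intro h
    rw [eq_top_iff, le_limsup_iff]
    intro y hy
    obtain ⟨r, hyr, -⟩ := EReal.lt_iff_exists_real_btwn.1 hy
    obtain ⟨k, hk⟩ := exists_nat_gt r
    refine frequently_atTop.2 fun M => ?_
    obtain ⟨n, hn, hu⟩ := h (max k M)
    refine ⟨n, (le_max_right _ _).trans hn, hyr.trans (EReal.coe_lt_coe_iff.2 ?_)⟩
    exact (hk.trans_le (Nat.cast_le.2 (le_max_left k M))).trans hu

theorem liminf_coe_eq_bot_iff (u : ℕ → ℝ) :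
    liminf (fun n => (u n : EReal)) atTop = ⊥ ↔ ∀ N : ℕ, ∃ n ≥ N, u n < -(N : ℝ) := by
  have h := limsup_coe_eq_top_iff (-u)
  have hneg : (fun n => (((-u) n : ℝ) : EReal)) = -fun n => (u n : EReal) := by
    ext n
    simp
  rw [hneg, EReal.limsup_neg, EReal.neg_eq_top_iff] at h
  rw [h]
  simp only [Pi.neg_apply, lt_neg]

/-- The pairs `(f, x)` for which `f_n(x)` lies in `S` for some `n ≥ N`. -/
def visits (D : ℕ → Set (Set Ω)) (Y : Set (Mp P ℱ p)) (N : ℕ) (S : Set ℝ) :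
    Set (Y × InverseLimit D) :=
  {q | ∃ n ≥ N, cellValue (q.1.1.seq n) (q.2.cell n) ∈ S}

namespace IsSplitting

theorem isOpen_visits [IsFiniteMeasure P] (H : IsSplitting P ℱ D) (hp : p ≠ ∞)
    (Y : Set (Mp P ℱ p)) (N : ℕ) {S : Set ℝ} (hS : IsOpen S) : IsOpen (visits D Y N S) := by
  rw [isOpen_iff_mem_nhds]
  rintro ⟨f, x⟩ ⟨n, hn, hfx⟩
  obtain ⟨ω, hω⟩ := H.exists_mem_cell x n
  have hval : ∀ g : Mp P ℱ p, cellValue (g.seq n) (x.cell n) = g.seq n ω := fun g => by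
    rw [hω, H.cellValue_cellAt (g.measurable_seq n)]
  have hO : IsOpen {g : Y | g.1.seq n ω ∈ S} :=
    hS.preimage ((H.uniformContinuous_eval hp n ω).continuous.comp continuous_subtype_val)
  have hfω : f.1.seq n ω ∈ S := hval f.1 ▸ hfx
  filter_upwards [(hO.prod (isOpen_cell_eq x n)).mem_nhds ⟨hfω, rfl⟩]
  rintro ⟨g, y⟩ ⟨hg, hy⟩
  refine ⟨n, hn, ?_⟩
  change cellValue (g.1.seq n) (y.cell n) ∈ S
  rw [show y.cell n = x.cell n from hy, hval]
  exact hg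

theorem dense_visits (H : IsSplitting P ℱ D) {Y : Set (Mp P ℱ p)}
    (hY : ∀ f ∈ Y, ∀ (m : ℕ) (ω₀ : Ω) (N : ℕ) (a ε : ℝ), 0 < ε →
      ∃ f' ∈ Y, dist f' f < ε ∧ ∃ n ≥ N, ∃ ω ∈ cellAt D m ω₀, f'.seq n ω = a)
    (N : ℕ) {S : Set ℝ} (hS : S.Nonempty) : Dense (visits D Y N S) := by
  obtain ⟨a, ha⟩ := hS
  rw [dense_iff_inter_open]
  rintro O hO ⟨⟨f, x⟩, hfx⟩
  obtain ⟨V, W, hV, hW, hfV, hxW, hVW⟩ := isOpen_prod_iff.1 hO f x hfx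
  obtain ⟨ε, hε, hball⟩ := Metric.isOpen_iff.1 hV f hfV
  obtain ⟨m, hm⟩ := H.exists_cell_eq_subset hW hxW
  obtain ⟨ω₀, hω₀⟩ := H.exists_mem_cell x m
  obtain ⟨f', hf'Y, hf', n, hn, ω, hω, hval⟩ := hY f.1 f.2 m ω₀ N a ε hε
  refine ⟨(⟨f', hf'Y⟩, H.toLimit ω), hVW ⟨hball hf', hm _ ?_⟩, n, hn, ?_⟩
  · exact (H.cellAt_eq_of_mem hω).trans hω₀.symm
  · change cellValue (f'.seq n) (cellAt D n ω) ∈ S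
    rwa [H.cellValue_cellAt (f'.measurable_seq n), hval]

/-- The Baire category argument: it is enough that, within the closed set `Y`, a small perturbation
can give a martingale any prescribed value inside any cell at some late time. -/
theorem typicallyOscillates [IsProbabilityMeasure P] (H : IsSplitting P ℱ D) (hp : p ≠ ∞)
    {Y : Set (Mp P ℱ p)} (hYc : IsClosed Y)
    (hY : ∀ f ∈ Y, ∀ (m : ℕ) (ω₀ : Ω) (N : ℕ) (a ε : ℝ), 0 < ε →
      ∃ f' ∈ Y, dist f' f < ε ∧ ∃ n ≥ N, ∃ ω ∈ cellAt D m ω₀, f'.seq n ω = a) :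
    TypicallyOscillates D Y := by
  have := H.completeSpace hp
  have : CompleteSpace Y := hYc.completeSpace_coe
  have := H.secondCountable
  have := H.baireSpace
  let U : ℕ × Bool → Set (Y × InverseLimit D) := fun i =>
    visits D Y i.1 (if i.2 then Set.Ioi (i.1 : ℝ) else Set.Iio (-(i.1 : ℝ)))
  have hUo : ∀ i, IsOpen (U i) := fun i => H.isOpen_visits hp Y _ (by
    split_ifs
    exacts [isOpen_Ioi, isOpen_Iio])
  have hUd : ∀ i, Dense (U i) := fun i => H.dense_visits hY _ (by
    split_ifs
    exacts [Set.nonempty_Ioi, Set.nonempty_Iio])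
  have hiff : ∀ q, q ∈ ⋂ i, U i ↔ Oscillates q.1.1 q.2 := by
    intro q
    rw [Set.mem_iInter, Oscillates, limsup_coe_eq_top_iff, liminf_coe_eq_bot_iff]
    constructor
    · exact fun h => ⟨fun N => h (N, true), fun N => h (N, false)⟩
    · rintro ⟨h1, h2⟩ ⟨N, b⟩
      cases b
      exacts [h2 N, h1 N]
  have heq : {q : Y × InverseLimit D | Oscillates q.1.1 q.2} = ⋂ i, U i :=
    Set.ext fun q => (hiff q).symm
  obtain ⟨hdense, A, hA, hAG, hAB⟩ := dense_iInter_and_sections hUo hUd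
  refine ⟨heq ▸ ⟨hdense, IsGδ.iInter_of_isOpen hUo⟩, A, hA, hAG, fun f hf => ?_⟩
  obtain ⟨B, hB, hBG, h⟩ := hAB f hf
  exact ⟨B, hB, hBG, fun x hx => (hiff (f, x)).1 (h x hx)⟩

/-- The perturbation needed in `IsSplitting.typicallyOscillates`, from perturbations of the zero
martingale that may be added within `Y`. -/
theorem exists_dist_lt_seq_eq [IsProbabilityMeasure P] (H : IsSplitting P ℱ D) (hp : p ≠ ∞)
    {Y : Set (Mp P ℱ p)} (hY : ∀ f ∈ Y, ∀ (n : ℕ) (ω : Ω) (c ε : ℝ), 0 ≤ ε →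
      ‖c‖ₑ * P (cellAt D n ω) ^ (1 / p.toReal) ≤ ENNReal.ofReal ε →
      ∃ g, f + g ∈ Y ∧ g.seq n ω = c ∧ ‖g‖ ≤ ε)
    {f : Mp P ℱ p} (hf : f ∈ Y) (m : ℕ) (ω₀ : Ω) (N : ℕ) (a ε : ℝ) (hε : 0 < ε) :
    ∃ f' ∈ Y, dist f' f < ε ∧ ∃ n ≥ N, ∃ ω ∈ cellAt D m ω₀, f'.seq n ω = a := by
  obtain ⟨n, hn, ω, hω, hsmall⟩ := H.exists_subcell_enorm_mul_lt hp f m ω₀ N a (half_pos hε)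
  obtain ⟨g, hg, hval, hnorm⟩ := hY f hf n ω _ _ (half_pos hε).le hsmall.le
  refine ⟨f + g, hg, ?_, n, hn, ω, hω, ?_⟩
  · rw [dist_eq_norm, add_sub_cancel_left]
    exact hnorm.trans_lt (half_lt_self hε)
  · rw [Mp.seq_add, Pi.add_apply, hval, add_sub_cancel]

theorem typicallyOscillates_univ [IsProbabilityMeasure P] (H : IsSplitting P ℱ D) (hp : p ≠ ∞) :
    TypicallyOscillates D (Set.univ : Set (Mp P ℱ p)) := by
  refine H.typicallyOscillates hp isClosed_univ fun f hf =>
    H.exists_dist_lt_seq_eq hp (fun f _ n ω c ε hε hc => ?_) hf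
  obtain ⟨g, hval, hnorm, -⟩ := H.exists_uniformIntegrable hp n ω c hε hc
  exact ⟨g, Set.mem_univ _, hval, hnorm⟩

theorem typicallyOscillates_M1u [IsProbabilityMeasure P] (H : IsSplitting P ℱ D) :
    TypicallyOscillates D (M1u P ℱ) := by
  refine H.typicallyOscillates ENNReal.one_ne_top isClosed_M1u fun f hf =>
    H.exists_dist_lt_seq_eq ENNReal.one_ne_top (fun f hf n ω c ε hε hc => ?_) hf
  obtain ⟨g, hval, hnorm, hg⟩ := H.exists_uniformIntegrable ENNReal.one_ne_top n ω c hε hc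
  exact ⟨g, add_mem_M1u hf hg, hval, hnorm⟩

theorem typicallyOscillates_M1s [IsProbabilityMeasure P] (H : IsSplitting P ℱ D) :
    TypicallyOscillates D (M1s P ℱ) := by
  refine H.typicallyOscillates ENNReal.one_ne_top isClosed_M1s fun f hf =>
    H.exists_dist_lt_seq_eq ENNReal.one_ne_top (fun f hf n ω c ε hε hc => ?_) hf
  rw [ENNReal.toReal_one, div_one, ENNReal.rpow_one] at hc
  obtain ⟨g, hg, hval, hnorm⟩ := H.exists_mem_M1s n ω c hε hc
  exact ⟨g, add_mem_M1s hf hg, hval, hnorm⟩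

end IsSplitting

end PartitionMartingale

end

open PartitionMartingale in
theorem theorem4p1 {Ω : Type*} {mΩ : MeasurableSpace Ω} (P : Measure Ω) [IsProbabilityMeasure P]
    (ℱ : Filtration ℕ mΩ) (D : ℕ → Set (Set Ω))
    (hfin : ∀ n, (D n).Finite)
    (hpart : ∀ n, Setoid.IsPartition (D n))
    (hgen : ∀ n, ℱ n = MeasurableSpace.generateFrom (D n))
    (hpos : ∀ n, ∀ d ∈ D n, 0 < P d)
    (hsplit : ∀ n, ∀ d ∈ D n, ∃ m > n, d ∉ D m) :
    TypicallyOscillates D (Set.univ : Set (Mp P ℱ 1)) ∧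
    TypicallyOscillates D (M1u P ℱ) ∧
    TypicallyOscillates D (M1s P ℱ) ∧
    ∀ (p : ℝ≥0∞) (hp : 1 < p), p < ∞ →
      haveI : Fact (1 ≤ p) := ⟨hp.le⟩
      TypicallyOscillates D (Set.univ : Set (Mp P ℱ p)) := by
  have H : IsSplitting P ℱ D := ⟨hfin, hpart, hgen, hpos, hsplit⟩
  refine ⟨H.typicallyOscillates_univ ENNReal.one_ne_top, H.typicallyOscillates_M1u,
    H.typicallyOscillates_M1s, fun p hp hp' => ?_⟩
  have : Fact (1 ≤ p) := ⟨hp.le⟩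
  exact H.typicallyOscillates_univ hp'.ne
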